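/- For a sequence $(f_n)_{n\ge 0}$ of functions $f_n\colon(0,1)\to(0,1)$, a set $M\subseteq\mathbb{R}$ is called $(f_n)$-microscopic if for every $\varepsilon\in(0,1)$ there is a sequence of intervals $(I_n)_{n\ge 0}$ with $M\subseteq\bigcup_{n\ge 0} I_n$ and $|I_n|\le f_n(\varepsilon)$ for all $n\ge 0$, where $|I|$ denotes the length of $I$. A set is called picoscopic if it is $(\varepsilon^{(n+1)!})_{n\ge 0}$-microscopic. Let $k\ge 0$ be an integer, and put $f_n(\varepsilon)=\varepsilon^{(n+1)!}$ for $0\le n<k$ and $f_n(\varepsilon)=\varepsilon^{(n+2)!}$ for $n\ge k$. Then there are an $(f_n)$-microscopic set $X\subseteq\mathbb{R}$ and a point $x\in\mathbb{R}$ such that $X\cup\{x\}$ is not $(f_n)$-microscopic. In particular, there is a picoscopic set which is not $(f_n)$-microscopic. -/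

import Mathlib

/-- `M ⊆ ℝ` is `(f n)`-microscopic: for every `ε ∈ (0, 1)` it is covered by a sequence of
intervals `I 0, I 1, …` (order-connected sets of reals) with `|I n| ≤ f n ε` for all `n`.
The length of an interval is its Lebesgue measure. Only the values of `f n` on `(0, 1)` matter. -/
def IsMicroscopic (f : ℕ → ℝ → ℝ) (M : Set ℝ) : Prop :=
  ∀ ε ∈ Set.Ioo (0 : ℝ) 1, ∃ I : ℕ → Set ℝ,
    (∀ n, (I n).OrdConnected) ∧ M ⊆ ⋃ n, I n ∧
      ∀ n, MeasureTheory.volume (I n) ≤ ENNReal.ofReal (f n ε)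

/-- A set is picoscopic if it is microscopic for the sequence `ε ↦ ε ^ (n + 1)!`. -/
def IsPicoscopic (M : Set ℝ) : Prop :=
  IsMicroscopic (fun n ε => ε ^ Nat.factorial (n + 1)) M

/-- The sequence of functions `ε ↦ ε ^ (n + 1)!` for `n < k` and `ε ↦ ε ^ (n + 2)!` for
`n ≥ k`. -/
def skipSeq (k : ℕ) (n : ℕ) (ε : ℝ) : ℝ :=
  if n < k then ε ^ Nat.factorial (n + 1) else ε ^ Nat.factorial (n + 2)

/-! Write `p n` for the exponents. The set is an intersection of covers; the `n`-th interval of the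
cover of stage `y` has length at most `eps ^ ((y + 1) * p n)`, so the set is microscopic. If adding
the point -10 kept it microscopic, then at scale `eps` the interval containing -10 would miss the
set. So it suffices that intervals `J l` of length at most `eps ^ p l`, one of them empty, never
cover the set (`Schedule.not_limitSet_subset`).

The covers come from a tree of intervals (nodes). A node of level `L` is unmet if no `J l` with `l <
L` meets it. An endless chain of unmet descendants would give an uncovered point by compactness, so
every unmet node contains an unmet one all of whose children are met in time
(`Schedule.exists_childrenMet`). Children are spread so evenly that such a node uses up well over
half of the `J l` available up to the end of each block of indices given to its children. Hence two
such nodes cannot share a block unless some `J l` meets both (`not_both_met`), and a schedule makes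
any two nodes of distinct stages share one.

One such node, of stage `s`, lies below `[0, 1]`. A rival comes from the cover of stage `s`: its
intervals are so well separated that meeting all of them in time would need every index, including
that of the empty `J k` (`Schedule.exists_cover_unmet`). This count needs all indices in use, but
the early ones are too early for nodes of stage `s + 1`; isolated intervals, the roots, fill these
places. -/

namespace Microscopic

/-! ### Growth of the exponents. -/

/-- Exponent sequences `p` with `p 0 ≥ 1` whose quotients `p (n + 1) / p n` are at least `n + 2`. -/
structure Growth (p : ℕ → ℕ) : Prop where
  one_le : 1 ≤ p 0
  mul_le : ∀ n, (n + 2) * p n ≤ p (n + 1)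

namespace Growth

variable {p : ℕ → ℕ}

theorem succ_le (hp : Growth p) (n : ℕ) : n + 1 ≤ p n := by
  induction n with
  | zero => exact hp.one_le
  | succ n ih => nlinarith [hp.mul_le n]

theorem monotone (hp : Growth p) : Monotone p :=
  monotone_nat_of_le_succ fun n => by nlinarith [hp.mul_le n, Nat.zero_le (n * p n)]

/-- Of the `l + 1` copies of `p (l - 1)` contained in `p l`, the first `l` absorb `h * p n` and the
last absorbs `l`. -/
theorem mul_add_le (hp : Growth p) {h n l : ℕ} (hh : h ≤ n + 1) (hl : n + 1 ≤ l) :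
    h * p n + l ≤ p l := by
  obtain ⟨j, rfl⟩ : ∃ j, l = j + 1 := ⟨l - 1, by omega⟩
  have h1 := hp.mul_le j
  have h2 : p n ≤ p j := hp.monotone (by omega)
  have h3 := hp.succ_le j
  have h4 : h * p n ≤ (j + 1) * p j := Nat.mul_le_mul (by omega) h2
  nlinarith

end Growth

/-- The scale at which the constructed sets are not coverable. -/
noncomputable def eps : ℝ := 1 / 1024

theorem eps_pos : 0 < eps := by norm_num [eps]

theorem eps_lt_one : eps < 1 := by norm_num [eps]

theorem eps_le_one : eps ≤ 1 := eps_lt_one.le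

theorem eps_pow_lt_one {p : ℕ → ℕ} (hp : Growth p) (l : ℕ) : eps ^ p l < 1 :=
  pow_lt_one₀ eps_pos.le eps_lt_one (by have := hp.succ_le l; omega)

/-! ### Blocks of indices. -/

def blockStart (b : ℕ) : ℕ := 4 ^ b - 1

def block (n : ℕ) : ℕ := Nat.log 4 (n + 1)

def rootCount (y : ℕ) : ℕ := blockStart (2 * y)

theorem blockStart_add_one (b : ℕ) : blockStart b + 1 = 4 ^ b := by
  have : 0 < 4 ^ b := by positivity
  unfold blockStart; omega

theorem blockStart_succ (b : ℕ) : blockStart (b + 1) = blockStart b + 3 * 4 ^ b := by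
  have := blockStart_add_one b
  have := blockStart_add_one (b + 1)
  rw [pow_succ] at this
  omega

theorem blockStart_mono : Monotone blockStart :=
  monotone_nat_of_le_succ fun b => by rw [blockStart_succ]; omega

theorem le_blockStart (b : ℕ) : b ≤ blockStart b := by
  induction b with
  | zero => simp
  | succ b ih =>
    rw [blockStart_succ]
    have : 0 < 4 ^ b := by positivity
    omega

theorem le_block_iff {b n : ℕ} : b ≤ block n ↔ blockStart b ≤ n := by
  unfold block
  rw [Nat.le_log_iff_pow_le (by norm_num) (by omega), ← blockStart_add_one]
  omega

theorem block_blockStart (b : ℕ) : block (blockStart b) = b := by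
  unfold block
  rw [blockStart_add_one, Nat.log_pow (by norm_num)]

theorem blockStart_block_le (n : ℕ) : blockStart (block n) ≤ n := le_block_iff.1 le_rfl

theorem block_eq_iff {b n : ℕ} : block n = b ↔ blockStart b ≤ n ∧ n < blockStart (b + 1) := by
  rw [← le_block_iff, ← not_le, ← le_block_iff]
  omega

theorem rootCount_zero : rootCount 0 = 0 := rfl

theorem rootCount_succ (y : ℕ) : 2 * rootCount y + 1 ≤ rootCount (y + 1) := by
  unfold rootCount
  rw [show 2 * (y + 1) = 2 * y + 1 + 1 by ring, blockStart_succ, blockStart_succ]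
  have := blockStart_add_one (2 * y)
  have : 0 < 4 ^ (2 * y + 1) := by positivity
  omega

theorem rootCount_mono : Monotone rootCount := fun a b h => blockStart_mono (by omega)

theorem rootCount_le_iff {y n : ℕ} : rootCount y ≤ n ↔ 2 * y ≤ block n := le_block_iff.symm

/-- Unbounded, so that the covers reach every power of `eps`, yet at most `n + 1`, so that the
growth of the exponents still beats it. -/
def heightFactor (n : ℕ) : ℕ := Nat.log 4 (n + 2) + 1

theorem heightFactor_le (n : ℕ) : heightFactor n ≤ n + 1 := by
  unfold heightFactor
  have : Nat.log 4 (n + 2) < n + 1 := by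
    apply Nat.log_lt_of_lt_pow (by omega)
    induction n with
    | zero => norm_num
    | succ n ih => rw [pow_succ]; omega
  omega

theorem lt_heightFactor {y n : ℕ} (h : rootCount y ≤ n + 1) : y < heightFactor n := by
  have h1 : 2 * y ≤ Nat.log 4 (n + 2) := by
    rw [rootCount_le_iff] at h
    simpa [block] using h
  unfold heightFactor
  omega

/-! ### Lengths of the intervals. -/

/-- The length of the intervals at a given level. -/
noncomputable def len (p : ℕ → ℕ) : ℕ → ℝ
  | 0 => 1
  | n + 1 => eps ^ (heightFactor n * p n)

theorem len_pos (p : ℕ → ℕ) (L : ℕ) : 0 < len p L := by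
  cases L with
  | zero => exact one_pos
  | succ n => exact pow_pos eps_pos _

theorem len_le_one (p : ℕ → ℕ) (L : ℕ) : len p L ≤ 1 := by
  cases L with
  | zero => exact le_rfl
  | succ n => exact pow_le_one₀ eps_pos.le eps_le_one

theorem eps_pow_le_half_pow (l : ℕ) : eps ^ (l + 1) ≤ 1 / 1024 * (1 / 2) ^ l := by
  rw [pow_succ, mul_comm]
  exact mul_le_mul le_rfl (pow_le_pow_left₀ eps_pos.le (by norm_num [eps]) l)
    (pow_nonneg eps_pos.le l) (by norm_num)

/-- A set `J l` with `l ≥ L` is tiny compared with an interval of level `L`. The factor `(1 / 2) ^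
l` keeps the sum over all `l` under control. -/
theorem eps_pow_le_len {p : ℕ → ℕ} (hp : Growth p) {L l : ℕ} (h : L ≤ l) :
    eps ^ p l ≤ 1 / 512 * (1 / 2) ^ l * len p L := by
  cases L with
  | zero =>
    have h1 : eps ^ p l ≤ eps ^ (l + 1) :=
      pow_le_pow_of_le_one eps_pos.le eps_le_one (hp.succ_le l)
    have h2 := eps_pow_le_half_pow l
    have : (0 : ℝ) < (1 / 2) ^ l := by positivity
    simp only [len]
    nlinarith
  | succ n =>
    have h1 : eps ^ p l ≤ eps ^ (heightFactor n * p n + l) :=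
      pow_le_pow_of_le_one eps_pos.le eps_le_one (hp.mul_add_le (heightFactor_le n) h)
    obtain ⟨j, rfl⟩ : ∃ j, l = j + 1 := ⟨l - 1, by omega⟩
    have h2 := eps_pow_le_half_pow j
    rw [pow_add] at h1
    have h3 : 0 < len p (n + 1) := len_pos p _
    simp only [len] at h3 ⊢
    have h4 : 1 / 512 * (1 / 2 : ℝ) ^ (j + 1) = 1 / 1024 * (1 / 2) ^ j := by
      rw [pow_succ]; ring
    rw [h4]
    nlinarith

theorem len_succ_le {p : ℕ → ℕ} (n : ℕ) : len p (n + 1) ≤ eps ^ p n := by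
  simp only [len]
  apply pow_le_pow_of_le_one eps_pos.le eps_le_one
  unfold heightFactor
  nlinarith [Nat.zero_le (Nat.log 4 (n + 2) * p n)]

theorem len_succ_le_len {p : ℕ → ℕ} (hp : Growth p) {L n : ℕ} (h : L ≤ n) :
    len p (n + 1) ≤ 1 / 512 * (1 / 2) ^ n * len p L :=
  (len_succ_le n).trans (eps_pow_le_len hp h)

/-! ### Positions of the children inside their parent. -/

/-- The relative position of an index in its block. -/
noncomputable def fraction (n : ℕ) : ℝ :=
  ((n : ℝ) - blockStart (block n)) / (3 * 4 ^ block n)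

theorem fraction_nonneg (n : ℕ) : 0 ≤ fraction n := by
  have : (blockStart (block n) : ℝ) ≤ n := by exact_mod_cast blockStart_block_le n
  unfold fraction
  have : 0 ≤ (n : ℝ) - blockStart (block n) := by linarith
  positivity

theorem fraction_le_one (n : ℕ) : fraction n ≤ 1 := by
  have h := (block_eq_iff (n := n).1 rfl).2
  rw [blockStart_succ] at h
  have h' : (n : ℝ) < blockStart (block n) + 3 * 4 ^ block n := by exact_mod_cast h
  unfold fraction
  rw [div_le_one (by positivity)]
  linarith

theorem abs_fraction_sub {m n : ℕ} (h : block m = block n) :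
    |fraction m - fraction n| = |(m : ℝ) - n| / (3 * 4 ^ block n) := by
  unfold fraction
  rw [h, ← sub_div, abs_div, abs_of_pos (a := (3 * 4 ^ block n : ℝ)) (by positivity)]
  congr 2
  ring

noncomputable def gap (n : ℕ) : ℝ := (1 / 2) ^ n / 8

theorem gap_pos (n : ℕ) : 0 < gap n := by unfold gap; positivity

theorem hasSum_gap : HasSum gap (1 / 4) := by
  have := hasSum_geometric_two.div_const 8
  rwa [show (2 : ℝ) / 8 = 1 / 4 by norm_num] at this

/-- The order of the children of a node: by relative position in the block, then by index. -/
def Before (m n : ℕ) : Prop := fraction m < fraction n ∨ fraction m = fraction n ∧ m < n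

theorem Before.trans {l m n : ℕ} (h : Before l m) (h' : Before m n) : Before l n := by
  rcases h with h | ⟨h, h1⟩ <;> rcases h' with h' | ⟨h', h1'⟩
  · exact Or.inl (h.trans h')
  · exact Or.inl (h' ▸ h)
  · exact Or.inl (h ▸ h')
  · exact Or.inr ⟨h.trans h', h1.trans h1'⟩

theorem Before.irrefl (n : ℕ) : ¬ Before n n := by
  rintro (h | ⟨_, h⟩)
  · exact lt_irrefl _ h
  · exact lt_irrefl _ h

theorem before_or {m n : ℕ} (h : m ≠ n) : Before m n ∨ Before n m := by
  rcases lt_trichotomy (fraction m) (fraction n) with h1 | h1 | h1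
  · exact Or.inl (Or.inl h1)
  · rcases lt_or_gt_of_ne h with h2 | h2
    · exact Or.inl (Or.inr ⟨h1, h2⟩)
    · exact Or.inr (Or.inr ⟨h1.symm, h2⟩)
  · exact Or.inr (Or.inl h1)

theorem summable_indicator_gap (s : Set ℕ) : Summable (s.indicator gap) :=
  hasSum_gap.summable.indicator s

/-- The relative position of the `n`-th child in its parent. -/
noncomputable def spread (n : ℕ) : ℝ :=
  fraction n / 2 + ∑' m, {m | Before m n}.indicator gap m + gap n / 2

theorem spread_nonneg (n : ℕ) : 0 ≤ spread n := by
  have h1 := fraction_nonneg n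
  have h2 : 0 ≤ ∑' m, {m | Before m n}.indicator gap m :=
    tsum_nonneg fun m => Set.indicator_nonneg (fun m _ => (gap_pos m).le) m
  have h3 := gap_pos n
  unfold spread
  linarith

theorem spread_le (n : ℕ) : spread n ≤ 13 / 16 := by
  have h1 := fraction_le_one n
  have h2 : ∑' m, {m | Before m n}.indicator gap m ≤ 1 / 4 := by
    rw [← hasSum_gap.tsum_eq]
    exact (summable_indicator_gap _).tsum_le_tsum
      (fun m => Set.indicator_le_self' (fun m _ => (gap_pos m).le) m) hasSum_gap.summable
  have h3 : gap n ≤ 1 / 8 := by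
    have : (1 / 2 : ℝ) ^ n ≤ 1 := pow_le_one₀ (by norm_num) (by norm_num)
    unfold gap
    linarith
  unfold spread
  linarith

/-- The sum for `n` contains `gap m` and all gaps in the sum for `m`. The fractions space the
children of one block evenly, for counting; the gaps separate children of different blocks. -/
theorem Before.spread_sub {m n : ℕ} (h : Before m n) :
    |fraction m - fraction n| / 2 + (gap m + gap n) / 2 ≤ spread n - spread m := by
  have h1 : fraction m ≤ fraction n := by
    rcases h with h | h
    · exact h.le
    · exact h.1.le
  have h2 : ∑' j, {j | Before j m}.indicator gap j + gap m ≤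
      ∑' j, {j | Before j n}.indicator gap j := by
    have h3 : gap m = ∑' j, ({m} : Set ℕ).indicator gap j := by
      rw [tsum_eq_single m (fun j hj => by simp [hj])]
      simp
    rw [h3, ← (summable_indicator_gap _).tsum_add (summable_indicator_gap _)]
    refine ((summable_indicator_gap _).add (summable_indicator_gap _)).tsum_le_tsum
      (fun j => ?_) (summable_indicator_gap _)
    by_cases hj : j = m
    · subst hj
      simp [h, Before.irrefl]
    · by_cases hj' : Before j m
      · simp [hj, hj', hj'.trans h]
      · simp only [Set.indicator_of_notMem (s := {i | Before i m}) hj',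
          Set.indicator_of_notMem (s := {m}) hj, add_zero]
        exact Set.indicator_nonneg (fun i _ => (gap_pos i).le) j
  rw [abs_sub_comm, abs_of_nonneg (by linarith)]
  unfold spread
  linarith

theorem le_abs_spread_sub {m n : ℕ} (h : m ≠ n) :
    |fraction m - fraction n| / 2 + (gap m + gap n) / 2 ≤ |spread m - spread n| := by
  rcases before_or h with h | h
  · rw [abs_sub_comm (spread m)]
    exact h.spread_sub.trans (le_abs_self _)
  · rw [abs_sub_comm (fraction m), add_comm (gap m)]
    exact h.spread_sub.trans (le_abs_self _)

/-- The interval of level `L` that starts at `a`. -/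
def seg (p : ℕ → ℕ) (a : ℝ) (L : ℕ) : Set ℝ := Set.Icc a (a + len p L)

/-- The `n`-th child of the interval of level `L` that starts at `a`. -/
noncomputable def child (p : ℕ → ℕ) (a : ℝ) (L n : ℕ) : Set ℝ :=
  seg p (a + len p L * spread n) (n + 1)

theorem child_subset {p : ℕ → ℕ} (hp : Growth p) (a : ℝ) {L n : ℕ} (h : L ≤ n) :
    child p a L n ⊆ seg p a L := by
  have h1 := len_succ_le_len hp h
  have h2 := len_pos p L
  have h3 := spread_nonneg n
  have h4 := spread_le n
  have h5 : (1 / 2 : ℝ) ^ n ≤ 1 := pow_le_one₀ (by norm_num) (by norm_num)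
  have h6 : len p (n + 1) ≤ 1 / 512 * len p L := h1.trans (by nlinarith)
  apply Set.Icc_subset_Icc
  · nlinarith
  · nlinarith

theorem child_dist {p : ℕ → ℕ} (hp : Growth p) (a : ℝ) {L m n : ℕ} (hm : L ≤ m) (hn : L ≤ n)
    (hmn : m ≠ n) {u v : ℝ} (hu : u ∈ child p a L m) (hv : v ∈ child p a L n) :
    len p L * (|fraction m - fraction n| / 2 + (gap m + gap n) / 4) ≤ |u - v| := by
  have h1 := len_succ_le_len hp hm
  have h2 := len_succ_le_len hp hn
  have h3 := len_pos p L
  have h4 := mul_le_mul_of_nonneg_left (le_abs_spread_sub hmn) h3.le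
  have h5 : (0 : ℝ) < (1 / 2) ^ m := by positivity
  have h6 : (0 : ℝ) < (1 / 2) ^ n := by positivity
  have h7 : len p L * |spread m - spread n| =
      |(a + len p L * spread m) - (a + len p L * spread n)| := by
    rw [show (a + len p L * spread m) - (a + len p L * spread n) =
      len p L * (spread m - spread n) by ring, abs_mul, abs_of_pos h3]
  have h8 : |(a + len p L * spread m) - (a + len p L * spread n)| ≤
      |u - v| + (len p (m + 1) + len p (n + 1)) := by
    obtain ⟨hu1, hu2⟩ := hu
    obtain ⟨hv1, hv2⟩ := hv
    have := le_abs_self (u - v)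
    have := neg_abs_le (u - v)
    rw [abs_le]
    constructor <;> linarith [len_pos p (m + 1), len_pos p (n + 1)]
  unfold gap at h4 ⊢
  nlinarith

/-- Relative to the parent, the gap around child `m` is of order `(1 / 2) ^ m / 32`, while `eps ^ p
m` is at most `(1 / 2) ^ m / 512`. -/
theorem child_sep {p : ℕ → ℕ} (hp : Growth p) (a : ℝ) {L m n : ℕ} (hm : L ≤ m) (hn : L ≤ n)
    (hmn : m ≠ n) {u v : ℝ} (hu : u ∈ child p a L m) (hv : v ∈ child p a L n) {l : ℕ}
    (hl : min m n ≤ l) : eps ^ p l < |u - v| := by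
  wlog h : m ≤ l generalizing m n u v
  · rw [abs_sub_comm]
    exact this hn hm hmn.symm hv hu (by rwa [min_comm]) (by omega)
  have h1 := child_dist hp a hm hn hmn hu hv
  have h2 : eps ^ p l ≤ eps ^ p m := pow_le_pow_of_le_one eps_pos.le eps_le_one (hp.monotone h)
  have h3 := eps_pow_le_len hp hm
  have h4 := len_pos p L
  have h5 : (0 : ℝ) < (1 / 2) ^ m := by positivity
  have h6 := gap_pos n
  have h7 : 0 ≤ |fraction m - fraction n| := abs_nonneg _
  have h8 : 1 / 512 * (1 / 2 : ℝ) ^ m * len p L < len p L * (gap m / 4) := by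
    unfold gap
    nlinarith [mul_pos h4 h5]
  have h9 : len p L * (gap m / 4) ≤
      len p L * (|fraction m - fraction n| / 2 + (gap m + gap n) / 4) := by
    apply mul_le_mul_of_nonneg_left _ h4.le
    linarith
  linarith

/-! ### Counting the sets needed to meet a whole block of children. -/

theorem card_le_of_diam (A : Finset ℕ) {D : ℝ} (hD : 0 ≤ D)
    (h : ∀ m ∈ A, ∀ n ∈ A, |(m : ℝ) - n| ≤ D) : (A.card : ℝ) ≤ 1 + D := by
  rcases A.eq_empty_or_nonempty with rfl | hA
  · simp; linarith
  have h1 : A ⊆ Finset.Icc (A.min' hA) (A.max' hA) := fun n hn =>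
    Finset.mem_Icc.2 ⟨A.min'_le n hn, A.le_max' n hn⟩
  have h2 := Finset.card_le_card h1
  have h4 := A.min'_le _ (A.max'_mem hA)
  rw [Nat.card_Icc] at h2
  have h3 := h _ (A.max'_mem hA) _ (A.min'_mem hA)
  have h5 : (A.card : ℝ) + A.min' hA ≤ A.max' hA + 1 := by
    have : A.card + A.min' hA ≤ A.max' hA + 1 := by omega
    exact_mod_cast this
  have := le_abs_self ((A.max' hA : ℝ) - A.min' hA)
  linarith

/-- The number of the sets `J l`, `l < blockStart (b + 1)`, that are needed to meet all children
with indices in the block `b`. -/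
theorem le_card_meeting {p : ℕ → ℕ} (hp : Growth p) {J : ℕ → Set ℝ}
    (hJ : ∀ l, ∀ u ∈ J l, ∀ v ∈ J l, |u - v| ≤ eps ^ p l) (a : ℝ) {L b : ℕ}
    (hL : L ≤ blockStart b) (hun : ∀ l < L, Disjoint (J l) (seg p a L))
    (hmet : ∀ n, block n = b → ∃ l ≤ n, ¬ Disjoint (J l) (child p a L n))
    (M : Finset ℕ) (hM : ∀ l < blockStart (b + 1), ¬ Disjoint (J l) (seg p a L) → l ∈ M) :
    (3 * 4 ^ b : ℝ) * (63 / 64) ≤ M.card := by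
  classical
  set B := Finset.Ico (blockStart b) (blockStart (b + 1)) with hB
  have hBmem : ∀ {n}, n ∈ B → block n = b ∧ L ≤ n := fun {n} hn => by
    rw [hB, Finset.mem_Ico] at hn
    exact ⟨block_eq_iff.2 hn, hL.trans hn.1⟩
  have hBcard : B.card = 3 * 4 ^ b := by
    rw [hB, Nat.card_Ico, blockStart_succ]; omega
  set A : ℕ → Finset ℕ := fun l => B.filter fun n => ¬ Disjoint (J l) (child p a L n) with hA
  set T : ℝ := 3 * 4 ^ b with hT
  have hTpos : 0 < T := by positivity
  have hmeet : ∀ {l n}, n ∈ A l → ¬ Disjoint (J l) (seg p a L) := fun {l n} hn hd => by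
    rw [hA] at hn
    obtain ⟨h1, h2⟩ := Finset.mem_filter.1 hn
    exact h2 (hd.mono_right (child_subset hp a (hBmem h1).2))
  have hcov : B ⊆ M.biUnion A := by
    intro n hn
    obtain ⟨l, hl, hd⟩ := hmet n (hBmem hn).1
    have hnA : n ∈ A l := Finset.mem_filter.2 ⟨hn, hd⟩
    refine Finset.mem_biUnion.2 ⟨l, hM l ?_ (hmeet hnA), hnA⟩
    have := (Finset.mem_Ico.1 hn).2
    omega
  -- Children `m`, `n` of one parent in this block are at least `len p L * |m - n| / (2 * T)` apart,
  -- while the diameter of `J l` is at most `len p L * (1 / 2) ^ l / 512`.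
  have hAcard : ∀ l, ((A l).card : ℝ) ≤ 1 + T / 256 * (1 / 2) ^ l := by
    intro l
    apply card_le_of_diam _ (by positivity)
    intro m hm n hn
    by_cases hmn : m = n
    · subst hmn
      simp only [sub_self, abs_zero]
      positivity
    have hl : L ≤ l := by
      by_contra hl
      exact hmeet hm (hun l (by omega))
    obtain ⟨hm1, hm2⟩ := Finset.mem_filter.1 hm
    obtain ⟨hn1, hn2⟩ := Finset.mem_filter.1 hn
    obtain ⟨u, hu, hu'⟩ := Set.not_disjoint_iff.1 hm2
    obtain ⟨v, hv, hv'⟩ := Set.not_disjoint_iff.1 hn2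
    have h1 := child_dist hp a (hBmem hm1).2 (hBmem hn1).2 hmn hu' hv'
    have h2 := hJ l u hu v hv
    have h3 := eps_pow_le_len hp hl
    have h4 := len_pos p L
    rw [abs_fraction_sub ((hBmem hm1).1.trans (hBmem hn1).1.symm), (hBmem hn1).1, ← hT] at h1
    have h5 : len p L * (|(m : ℝ) - n| / T / 2) ≤ len p L * (1 / 512 * (1 / 2) ^ l) := by
      have := mul_nonneg h4.le (add_nonneg (gap_pos m).le (gap_pos n).le)
      nlinarith
    have h6 := le_of_mul_le_mul_left h5 h4
    rw [div_div, div_le_iff₀ (by positivity)] at h6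
    linarith
  have h1 : (B.card : ℝ) ≤ ∑ l ∈ M, ((A l).card : ℝ) := by
    exact_mod_cast (Finset.card_le_card hcov).trans Finset.card_biUnion_le
  have h2 : ∑ l ∈ M, ((A l).card : ℝ) ≤ ∑ l ∈ M, (1 + T / 256 * (1 / 2) ^ l) :=
    Finset.sum_le_sum fun l _ => hAcard l
  -- Summed over all `l`, the excess over one child per set is at most `T / 128`.
  have h3 : ∑ l ∈ M, (1 / 2 : ℝ) ^ l ≤ 2 :=
    sum_le_hasSum M (fun _ _ => by positivity) hasSum_geometric_two
  rw [Finset.sum_add_distrib, ← Finset.mul_sum] at h2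
  simp only [Finset.sum_const, nsmul_eq_mul, mul_one] at h2
  rw [hBcard] at h1
  push_cast at h1
  nlinarith

/-- Two intervals cannot both use up a whole block of the sets `J l` if no `J l` meets both. -/
theorem not_both_met {p : ℕ → ℕ} (hp : Growth p) {J : ℕ → Set ℝ}
    (hJ : ∀ l, ∀ u ∈ J l, ∀ v ∈ J l, |u - v| ≤ eps ^ p l) (a a' : ℝ) {L L' b : ℕ}
    (hL : L ≤ blockStart b) (hun : ∀ l < L, Disjoint (J l) (seg p a L))
    (hmet : ∀ n, block n = b → ∃ l ≤ n, ¬ Disjoint (J l) (child p a L n))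
    (hL' : L' ≤ blockStart b) (hun' : ∀ l < L', Disjoint (J l) (seg p a' L'))
    (hmet' : ∀ n, block n = b → ∃ l ≤ n, ¬ Disjoint (J l) (child p a' L' n))
    (hdisj : ∀ l, ¬ Disjoint (J l) (seg p a L) → ¬ Disjoint (J l) (seg p a' L') → False) :
    False := by
  classical
  set R := Finset.range (blockStart (b + 1))
  set M := R.filter fun l => ¬ Disjoint (J l) (seg p a L)
  set M' := R.filter fun l => ¬ Disjoint (J l) (seg p a' L')
  have h1 := le_card_meeting hp hJ a hL hun hmet M fun l hl h =>
    Finset.mem_filter.2 ⟨Finset.mem_range.2 hl, h⟩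
  have h2 := le_card_meeting hp hJ a' hL' hun' hmet' M' fun l hl h =>
    Finset.mem_filter.2 ⟨Finset.mem_range.2 hl, h⟩
  have h3 : Disjoint M M' := Finset.disjoint_left.2 fun l hl hl' =>
    hdisj l (Finset.mem_filter.1 hl).2 (Finset.mem_filter.1 hl').2
  have h4 : M.card + M'.card ≤ blockStart (b + 1) := by
    rw [← Finset.card_union_of_disjoint h3]
    have := Finset.card_le_card (Finset.union_subset (Finset.filter_subset _ R : M ⊆ R)
      (Finset.filter_subset _ R : M' ⊆ R))
    simpa [R] using this
  have h5 : (M.card : ℝ) + M'.card + 1 ≤ 4 * 4 ^ b := by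
    have := blockStart_add_one (b + 1)
    rw [pow_succ] at this
    exact_mod_cast (by omega : M.card + M'.card + 1 ≤ 4 * 4 ^ b)
  -- The two demands add up to `6 * 63 / 64 > 4` times `4 ^ b`.
  have : (0 : ℝ) < 4 ^ b := by positivity
  linarith

/-! ### Codes of nodes and the schedule of blocks. -/

/-- Nodes of stage `s + 1` are coded by numbers `2 * n` (the `n`-th child of a node of stage `s`)
and `2 * n + 1` (the `n`-th child of a root of stage `s`); `0` codes the only node of stage `0`. -/
def Valid (top : ℕ → ℕ) : ℕ → ℕ → Prop
  | 0, c => c = 0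
  | s + 1, c => 2 * s ≤ block (c / 2) ∧
      (c % 2 = 0 ∧ top (block (c / 2)) ≤ s ∨ c % 2 = 1 ∧ top (block (c / 2)) = s ∧ 1 ≤ s)

def level : ℕ → ℕ → ℕ
  | 0, _ => 0
  | _ + 1, c => c / 2 + 1

theorem valid_even {top : ℕ → ℕ} {s n : ℕ} :
    Valid top (s + 1) (2 * n) ↔ 2 * s ≤ block n ∧ top (block n) ≤ s := by
  have h1 : 2 * n / 2 = n := by omega
  have h2 : 2 * n % 2 = 0 := by omega
  simp [Valid, h1, h2]

theorem valid_odd {top : ℕ → ℕ} {s n : ℕ} :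
    Valid top (s + 1) (2 * n + 1) ↔ 2 * s ≤ block n ∧ top (block n) = s ∧ 1 ≤ s := by
  have h1 : (2 * n + 1) / 2 = n := by omega
  have h2 : (2 * n + 1) % 2 = 1 := by omega
  simp [Valid, h1, h2]

theorem level_even (s n : ℕ) : level (s + 1) (2 * n) = n + 1 := by
  simp [level]

theorem level_odd (s n : ℕ) : level (s + 1) (2 * n + 1) = n + 1 := by
  simp only [level]; omega

theorem valid_cases {top : ℕ → ℕ} {s c : ℕ} (h : Valid top (s + 1) c) :
    (∃ n, c = 2 * n ∧ 2 * s ≤ block n ∧ top (block n) ≤ s) ∨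
      ∃ n, c = 2 * n + 1 ∧ 2 * s ≤ block n ∧ top (block n) = s ∧ 1 ≤ s := by
  rcases Nat.even_or_odd' c with ⟨n, rfl | rfl⟩
  · exact Or.inl ⟨n, rfl, valid_even.1 h⟩
  · exact Or.inr ⟨n, rfl, valid_odd.1 h⟩

/-- An assignment of the blocks of indices to nodes and roots. The indices in the block `b` are used
by the root number `root b` of stage `top b` in all covers of stage below `top b`, and
by the node `parent b s` in the cover of every stage `s ≥ top b`. Any two nodes of distinct stages,
and any node and root of the same stage, share a block. -/
structure Schedule where
  top : ℕ → ℕ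
  root : ℕ → ℕ
  parent : ℕ → ℕ → ℕ
  two_mul_top_le : ∀ b, 2 * top b ≤ b
  root_lt : ∀ b, 1 ≤ top b → root b < rootCount (top b)
  valid_parent : ∀ b s, top b ≤ s → 2 * s ≤ b →
    Valid top s (parent b s) ∧ level s (parent b s) ≤ blockStart b
  exists_pair : ∀ s s' c c', s < s' → Valid top s c → Valid top s' c' →
    ∃ b, 2 * s' ≤ b ∧ top b ≤ s ∧ level s c ≤ blockStart b ∧ level s' c' ≤ blockStart b ∧
      parent b s = c ∧ parent b s' = c'
  exists_root : ∀ s c m, 1 ≤ s → Valid top s c → m < rootCount s →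
    ∃ b, 2 * s ≤ b ∧ level s c ≤ blockStart b ∧ top b = s ∧ root b = m ∧ parent b s = c

/-- Each request recurs forever, so it can be served in a block beyond any prescribed bound. -/
theorem exists_seq_forall_exists_ge (α : Type) [Encodable α] [Inhabited α] :
    ∃ f : ℕ → α, ∀ a N, ∃ i, N ≤ i ∧ f i = a :=
  ⟨fun i => (Encodable.decode i.unpair.1).getD default, fun a N =>
    ⟨Nat.pair (Encodable.encode a) N, Nat.right_le_pair _ _, by simp⟩⟩

/-- Even blocks will have `top` equal to 0, which makes index `blockStart (2 * s)` admissible at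
stage `s + 1`. -/
def defaultNode : ℕ → ℕ
  | 0 => 0
  | s + 1 => 2 * blockStart (2 * s)

theorem exists_schedule : Nonempty Schedule := by
  classical
  obtain ⟨f, hf⟩ := exists_seq_forall_exists_ge (ℕ × ℕ × ℕ × ℕ × ℕ × ℕ)
  -- The odd block `2 * i + 1` serves the request `f i`, which lists the stage and number of a root
  -- and then two nodes, each preceded by its stage. Requests that do not fit fall back to defaults.
  set top : ℕ → ℕ := fun b =>
    if b % 2 = 1 ∧ 2 * (f (b / 2)).1 ≤ b ∧ (f (b / 2)).2.1 < rootCount (f (b / 2)).1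
    then (f (b / 2)).1 else 0 with htop
  set parent : ℕ → ℕ → ℕ := fun b s =>
    if b % 2 = 1 ∧ s = (f (b / 2)).2.2.1 ∧ Valid top s (f (b / 2)).2.2.2.1 ∧
      level s (f (b / 2)).2.2.2.1 ≤ blockStart b then (f (b / 2)).2.2.2.1
    else if b % 2 = 1 ∧ s = (f (b / 2)).2.2.2.2.1 ∧ Valid top s (f (b / 2)).2.2.2.2.2 ∧
      level s (f (b / 2)).2.2.2.2.2 ≤ blockStart b then (f (b / 2)).2.2.2.2.2
    else defaultNode s with hparent
  have hdiv : ∀ i, (2 * i + 1) / 2 = i := fun i => by omega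
  have hmod : ∀ i, (2 * i + 1) % 2 = 1 := fun i => by omega
  refine ⟨⟨top, fun b => (f (b / 2)).2.1, parent, fun b => ?_, fun b h => ?_, fun b s h hs => ?_,
    fun s s' c c' hs hc hc' => ?_, fun s c m hs hc hm => ?_⟩⟩
  · simp only [htop]
    split_ifs with h
    · exact h.2.1
    · omega
  · simp only [htop] at h ⊢
    split_ifs with h'
    · exact h'.2.2
    · rw [if_neg h'] at h
      omega
  · simp only [hparent]
    split_ifs with h1 h2
    · exact h1.2.2
    · exact h2.2.2
    · cases s with
      | zero => exact ⟨rfl, Nat.zero_le _⟩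
      | succ s =>
        have h0 : top (2 * s) = 0 := by
          simp only [htop]
          rw [if_neg]
          rintro ⟨h, -⟩
          omega
        refine ⟨valid_even.2 ?_, ?_⟩
        · rw [block_blockStart, h0]
          exact ⟨le_rfl, Nat.zero_le _⟩
        · rw [defaultNode, level_even]
          have h1 := blockStart_succ (2 * s)
          have h2 : blockStart (2 * s + 1) ≤ blockStart b := blockStart_mono (by omega)
          have h3 : 0 < 4 ^ (2 * s) := by positivity
          omega
  -- The root part `(0, 0)` leaves `top` at 0, since `rootCount 0 = 0`.
  · obtain ⟨i, hi, hfi⟩ := hf (0, 0, s, c, s', c') (2 * s' + level s c + level s' c')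
    have hb := le_blockStart (2 * i + 1)
    have h0 : top (2 * i + 1) = 0 := by
      simp only [htop, hdiv, hfi]
      simp
    refine ⟨2 * i + 1, by omega, by omega, by omega, by omega, ?_, ?_⟩
    · simp only [hparent, hdiv, hmod, hfi]
      rw [if_pos ⟨trivial, trivial, hc, by omega⟩]
    · simp only [hparent, hdiv, hmod, hfi]
      rw [if_neg (fun h => hs.ne' h.2.1), if_pos ⟨trivial, trivial, hc', by omega⟩]
  · obtain ⟨i, hi, hfi⟩ := hf (s, m, s, c, s, c) (2 * s + level s c)
    have hb := le_blockStart (2 * i + 1)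
    refine ⟨2 * i + 1, by omega, by omega, ?_, ?_, ?_⟩
    · simp only [htop, hdiv, hmod, hfi]
      rw [if_pos ⟨trivial, by omega, hm⟩]
    · simp only [hdiv, hfi]
    · simp only [hparent, hdiv, hmod, hfi]
      rw [if_pos ⟨trivial, trivial, hc, by omega⟩]

/-! ### Positions of the roots. -/

/-- Roots have length at most 1 and spacing 2; those of stage `y` lie to the right of all nodes of
stage at most `y`. -/
noncomputable def rootPos (y m : ℕ) : ℝ := 2 + 2 * (rootCount y + m)

def rootSeg (p : ℕ → ℕ) (y m : ℕ) : Set ℝ := seg p (rootPos y m) (rootCount y)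

theorem rootSeg_subset (p : ℕ → ℕ) {y m : ℕ} (hm : m < rootCount y) :
    rootSeg p y m ⊆ Set.Icc (2 * rootCount y + 2 : ℝ) (2 * rootCount (y + 1) + 1) := by
  have h1 := len_le_one p (rootCount y)
  have h2 : (2 * rootCount y + 1 : ℝ) ≤ rootCount (y + 1) := by exact_mod_cast rootCount_succ y
  have h3 : (m + 1 : ℝ) ≤ rootCount y := by exact_mod_cast hm
  have h4 : (0 : ℝ) ≤ m := m.cast_nonneg
  apply Set.Icc_subset_Icc <;> unfold rootPos <;> linarith

theorem rootSeg_dist (p : ℕ → ℕ) {y y' m m' : ℕ} (hm : m < rootCount y) (hm' : m' < rootCount y')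
    (h : y = y' → m ≠ m') {u v : ℝ} (hu : u ∈ rootSeg p y m) (hv : v ∈ rootSeg p y' m') :
    1 ≤ |u - v| := by
  wlog hlt : y < y' ∨ y = y' ∧ m < m' generalizing y y' m m' u v
  · rw [abs_sub_comm]
    exact this hm' hm (fun h1 h2 => h h1.symm h2.symm) hv hu (by omega)
  rw [abs_sub_comm]
  refine le_trans ?_ (le_abs_self _)
  rcases hlt with hlt | ⟨rfl, hlt⟩
  · have h1 := (rootSeg_subset p hm hu).2
    have h2 := (rootSeg_subset p hm' hv).1
    have h3 : (rootCount (y + 1) : ℝ) ≤ rootCount y' := by exact_mod_cast rootCount_mono hlt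
    linarith
  · have h1 := hu.2
    have h2 := hv.1
    have h3 := len_le_one p (rootCount y)
    have h4 : (m + 1 : ℝ) ≤ m' := by exact_mod_cast hlt
    unfold rootPos at h1 h2
    linarith

/-! ### Nodes and their separation. -/

namespace Schedule

variable (S : Schedule) {p : ℕ → ℕ}

/-- The left end point of a node. -/
noncomputable def nodePos (p : ℕ → ℕ) : ℕ → ℕ → ℝ
  | 0, _ => 0
  | s + 1, c =>
    if c % 2 = 0 then
      nodePos p s (S.parent (block (c / 2)) s) +
        len p (level s (S.parent (block (c / 2)) s)) * spread (c / 2)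
    else rootPos s (S.root (block (c / 2))) + len p (rootCount s) * spread (c / 2)

noncomputable def node (p : ℕ → ℕ) (s c : ℕ) : Set ℝ := seg p (S.nodePos p s c) (level s c)

theorem node_even (s n : ℕ) : S.node p (s + 1) (2 * n) =
    child p (S.nodePos p s (S.parent (block n) s)) (level s (S.parent (block n) s)) n := by
  have h1 : 2 * n / 2 = n := by omega
  simp [node, child, nodePos, level, h1]

theorem node_odd (s n : ℕ) : S.node p (s + 1) (2 * n + 1) =
    child p (rootPos s (S.root (block n))) (rootCount s) n := by
  have h1 : (2 * n + 1) / 2 = n := by omega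
  have h2 : (2 * n + 1) % 2 = 1 := by omega
  simp [node, child, nodePos, level, h1, h2]

theorem level_parent_le {s n : ℕ} (h : 2 * s ≤ block n) (h' : S.top (block n) ≤ s) :
    level s (S.parent (block n) s) ≤ n :=
  (S.valid_parent _ _ h' h).2.trans (blockStart_block_le n)

theorem node_even_subset (hp : Growth p) {s n : ℕ} (h : 2 * s ≤ block n)
    (h' : S.top (block n) ≤ s) :
    S.node p (s + 1) (2 * n) ⊆ S.node p s (S.parent (block n) s) := by
  rw [node_even]
  exact child_subset hp _ (S.level_parent_le h h')

theorem node_odd_subset (hp : Growth p) {s n : ℕ} (h : 2 * s ≤ block n) :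
    S.node p (s + 1) (2 * n + 1) ⊆ rootSeg p s (S.root (block n)) := by
  rw [node_odd]
  exact child_subset hp _ (rootCount_le_iff.2 h)

theorem node_subset_Icc (hp : Growth p) {s c : ℕ} (h : Valid S.top s c) :
    S.node p s c ⊆ Set.Icc (0 : ℝ) (2 * rootCount s + 1) := by
  induction s generalizing c with
  | zero =>
    apply Set.Icc_subset_Icc
    · exact le_rfl
    · simp [nodePos, level, len, rootCount_zero]
  | succ s ih =>
    have h1 : (2 * rootCount s + 1 : ℝ) ≤ rootCount (s + 1) := by exact_mod_cast rootCount_succ s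
    have h2 : (0 : ℝ) ≤ rootCount s := Nat.cast_nonneg _
    rcases valid_cases h with ⟨n, rfl, hb, ht⟩ | ⟨n, rfl, hb, ht, hs⟩
    · refine (S.node_even_subset hp hb ht).trans ((ih (S.valid_parent _ _ ht hb).1).trans ?_)
      apply Set.Icc_subset_Icc <;> linarith
    · have hr := S.root_lt (block n) (by omega)
      rw [ht] at hr
      refine (S.node_odd_subset hp hb).trans ((rootSeg_subset p hr).trans ?_)
      apply Set.Icc_subset_Icc <;> linarith

theorem node_dist_rootSeg (hp : Growth p) {s c y m : ℕ} (h : Valid S.top s c) (hsy : s ≤ y)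
    (hm : m < rootCount y) {u v : ℝ} (hu : u ∈ S.node p s c) (hv : v ∈ rootSeg p y m) :
    1 ≤ |u - v| := by
  have h1 := (S.node_subset_Icc hp h hu).2
  have h2 := (rootSeg_subset p hm hv).1
  have h3 : (rootCount s : ℝ) ≤ rootCount y := by exact_mod_cast rootCount_mono hsy
  rw [abs_sub_comm]
  refine le_trans ?_ (le_abs_self _)
  linarith

/-- Siblings are separated by `child_sep`. Otherwise the parents are already separated, and their
levels do not exceed the indices of the children, so induction applies; distinct roots are at
distance at least 1. -/
theorem node_sep (hp : Growth p) {s c c' : ℕ} (h : Valid S.top s c) (h' : Valid S.top s c')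
    (hcc : c ≠ c') {u v : ℝ} (hu : u ∈ S.node p s c) (hv : v ∈ S.node p s c') {l : ℕ}
    (hl : min (level s c) (level s c') ≤ l + 1) : eps ^ p l < |u - v| := by
  induction s generalizing c c' l with
  | zero => exact absurd (h.trans h'.symm) hcc
  | succ s ih =>
    rcases valid_cases h with ⟨n, rfl, hb, ht⟩ | ⟨n, rfl, hb, ht, hs⟩ <;>
    rcases valid_cases h' with ⟨n', rfl, hb', ht'⟩ | ⟨n', rfl, hb', ht', hs'⟩ <;>
    simp only [level_even, level_odd] at hl
    · by_cases hpar : S.parent (block n) s = S.parent (block n') s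
      · have h1 := S.level_parent_le hb ht
        have h2 := S.level_parent_le hb' ht'
        rw [node_even] at hu hv
        rw [← hpar] at hv h2
        exact child_sep hp _ h1 h2 (by omega) hu hv (by omega)
      · have h1 := S.level_parent_le hb ht
        have h2 := S.level_parent_le hb' ht'
        exact ih (S.valid_parent _ _ ht hb).1 (S.valid_parent _ _ ht' hb').1 hpar
          (S.node_even_subset hp hb ht hu) (S.node_even_subset hp hb' ht' hv) (by omega)
    · have hr := S.root_lt (block n') (by omega)
      rw [ht'] at hr
      exact (eps_pow_lt_one hp l).trans_le (S.node_dist_rootSeg hp (S.valid_parent _ _ ht hb).1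
        le_rfl hr (S.node_even_subset hp hb ht hu) (S.node_odd_subset hp hb' hv))
    · have hr := S.root_lt (block n) (by omega)
      rw [ht] at hr
      rw [abs_sub_comm]
      exact (eps_pow_lt_one hp l).trans_le (S.node_dist_rootSeg hp (S.valid_parent _ _ ht' hb').1
        le_rfl hr (S.node_even_subset hp hb' ht' hv) (S.node_odd_subset hp hb hu))
    · have hr := S.root_lt (block n) (by omega)
      have hr' := S.root_lt (block n') (by omega)
      rw [ht] at hr
      rw [ht'] at hr'
      by_cases hroot : S.root (block n) = S.root (block n')
      · rw [node_odd] at hu hv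
        rw [← hroot] at hv
        exact child_sep hp _ (rootCount_le_iff.2 hb) (rootCount_le_iff.2 hb') (by omega) hu hv
          (by omega)
      · exact (eps_pow_lt_one hp l).trans_le (rootSeg_dist p hr hr' (fun _ => hroot)
          (S.node_odd_subset hp hb hu) (S.node_odd_subset hp hb' hv))

/-! ### The covers and their intersection. -/

/-- The `n`-th interval of the cover of stage `y`. -/
noncomputable def cover (p : ℕ → ℕ) (y n : ℕ) : Set ℝ :=
  if n < rootCount y then rootSeg p y n
  else if S.top (block n) ≤ y then S.node p (y + 1) (2 * n)
  else S.node p (S.top (block n) + 1) (2 * n + 1)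

/-- The set of all points that belong to all covers. -/
def limitSet (p : ℕ → ℕ) : Set ℝ := ⋂ y, ⋃ n, S.cover p y n

theorem cover_of_lt {y n : ℕ} (h : n < rootCount y) : S.cover p y n = rootSeg p y n := if_pos h

theorem cover_of_top_le {y n : ℕ} (h : rootCount y ≤ n) (h' : S.top (block n) ≤ y) :
    S.cover p y n = S.node p (y + 1) (2 * n) := by
  rw [cover, if_neg (by omega), if_pos h']

theorem cover_of_lt_top {y n : ℕ} (h : rootCount y ≤ n) (h' : y < S.top (block n)) :
    S.cover p y n = S.node p (S.top (block n) + 1) (2 * n + 1) := by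
  rw [cover, if_neg (by omega), if_neg (by omega)]

theorem cover_lt_top_subset (hp : Growth p) {y n : ℕ} (h : rootCount y ≤ n)
    (h' : y < S.top (block n)) :
    S.cover p y n ⊆ rootSeg p (S.top (block n)) (S.root (block n)) := by
  rw [S.cover_of_lt_top h h']
  exact S.node_odd_subset hp (S.two_mul_top_le _)

theorem cover_eq_seg (p : ℕ → ℕ) (y n : ℕ) :
    ∃ a, S.cover p y n = seg p a (if n < rootCount y then rootCount y else n + 1) := by
  by_cases h : n < rootCount y
  · exact ⟨_, by rw [S.cover_of_lt h, if_pos h, rootSeg]⟩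
  · rw [if_neg h]
    by_cases h' : S.top (block n) ≤ y
    · exact ⟨_, by rw [S.cover_of_top_le (by omega) h', node, level_even]⟩
    · exact ⟨_, by rw [S.cover_of_lt_top (by omega) (by omega), node, level_odd]⟩

theorem cover_dist_root (hp : Growth p) {y m n : ℕ} (hm : m < rootCount y) (hmn : m ≠ n) {u v : ℝ}
    (hu : u ∈ S.cover p y m) (hv : v ∈ S.cover p y n) : 1 ≤ |u - v| := by
  rw [S.cover_of_lt hm] at hu
  by_cases hn : n < rootCount y
  · rw [S.cover_of_lt hn] at hv
    exact rootSeg_dist p hm hn (fun _ => hmn) hu hv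
  · have hb : 2 * y ≤ block n := rootCount_le_iff.1 (by omega)
    by_cases ht : S.top (block n) ≤ y
    · rw [S.cover_of_top_le (by omega) ht] at hv
      rw [abs_sub_comm]
      exact S.node_dist_rootSeg hp (S.valid_parent _ _ ht hb).1 le_rfl hm
        (S.node_even_subset hp hb ht hv) hu
    · exact rootSeg_dist p hm (S.root_lt _ (by omega)) (by omega) hu
        (S.cover_lt_top_subset hp (by omega) (by omega) hv)

theorem cover_sep (hp : Growth p) {y m n : ℕ} (hm : rootCount y ≤ m) (hmn : m < n) {u v : ℝ}
    (hu : u ∈ S.cover p y m) (hv : v ∈ S.cover p y n) : eps ^ p m < |u - v| := by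
  have hn : rootCount y ≤ n := by omega
  have hbm : 2 * y ≤ block m := rootCount_le_iff.1 hm
  have hbn : 2 * y ≤ block n := rootCount_le_iff.1 hn
  by_cases htm : S.top (block m) ≤ y <;> by_cases htn : S.top (block n) ≤ y
  · rw [S.cover_of_top_le hm htm] at hu
    rw [S.cover_of_top_le hn htn] at hv
    refine S.node_sep hp (valid_even.2 ⟨hbm, htm⟩) (valid_even.2 ⟨hbn, htn⟩) (by omega) hu hv ?_
    simp only [level_even]
    omega
  · rw [S.cover_of_top_le hm htm] at hu
    exact (eps_pow_lt_one hp m).trans_le (S.node_dist_rootSeg hp (S.valid_parent _ _ htm hbm).1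
      (by omega) (S.root_lt _ (by omega)) (S.node_even_subset hp hbm htm hu)
      (S.cover_lt_top_subset hp hn (by omega) hv))
  · rw [S.cover_of_top_le hn htn] at hv
    rw [abs_sub_comm]
    exact (eps_pow_lt_one hp m).trans_le (S.node_dist_rootSeg hp (S.valid_parent _ _ htn hbn).1
      (by omega) (S.root_lt _ (by omega)) (S.node_even_subset hp hbn htn hv)
      (S.cover_lt_top_subset hp hm (by omega) hu))
  · by_cases h : S.top (block m) = S.top (block n) ∧ S.root (block m) = S.root (block n)
    · rw [S.cover_of_lt_top hm (by omega), node_odd] at hu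
      rw [S.cover_of_lt_top hn (by omega), node_odd, ← h.1, ← h.2] at hv
      refine child_sep hp _ ?_ ?_ hmn.ne hu hv (by omega)
      · exact rootCount_le_iff.2 (S.two_mul_top_le _)
      · rw [h.1]
        exact rootCount_le_iff.2 (S.two_mul_top_le _)
    · exact (eps_pow_lt_one hp m).trans_le (rootSeg_dist p (S.root_lt _ (by omega))
        (S.root_lt _ (by omega)) (by tauto) (S.cover_lt_top_subset hp hm (by omega) hu)
        (S.cover_lt_top_subset hp hn (by omega) hv))

/-- A piece of a root of stage `s` is itself an interval of every cover of stage below `s`, and in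
the cover of stage `s` it lies in its root. -/
theorem node_subset_iUnion_cover (hp : Growth p) {s c : ℕ} (h : Valid S.top s c) {y : ℕ}
    (hy : y < s) : S.node p s c ⊆ ⋃ n, S.cover p y n := by
  induction s generalizing c with
  | zero => omega
  | succ s ih =>
    rcases valid_cases h with ⟨n, rfl, hb, ht⟩ | ⟨n, rfl, hb, ht, hs⟩
    · rcases Nat.lt_succ_iff_lt_or_eq.1 hy with hy | rfl
      · exact (S.node_even_subset hp hb ht).trans (ih (S.valid_parent _ _ ht hb).1 hy)
      · rw [← S.cover_of_top_le (rootCount_le_iff.2 hb) ht]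
        exact Set.subset_iUnion _ n
    · rcases Nat.lt_succ_iff_lt_or_eq.1 hy with hy | rfl
      · have h1 : rootCount y ≤ n := rootCount_le_iff.2 (by omega)
        have h2 := S.cover_of_lt_top (p := p) h1 (by omega)
        rw [ht] at h2
        rw [← h2]
        exact Set.subset_iUnion _ n
      · have hr := S.root_lt (block n) (by omega)
        rw [ht] at hr
        refine (S.node_odd_subset hp hb).trans ?_
        rw [← S.cover_of_lt hr]
        exact Set.subset_iUnion _ _

/-- An index below `rootCount y` carries a root of level `rootCount y`, which is short enough for
all these indices at once. -/
theorem volume_cover_le (p : ℕ → ℕ) (hp : Growth p) (y n : ℕ) :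
    MeasureTheory.volume (S.cover p y n) ≤ ENNReal.ofReal ((eps ^ (y + 1)) ^ p n) := by
  obtain ⟨a, ha⟩ := S.cover_eq_seg p y n
  rw [ha, seg, Real.volume_Icc, add_sub_cancel_left]
  apply ENNReal.ofReal_le_ofReal
  rw [← pow_mul]
  have key : ∀ j, rootCount y ≤ j + 1 → p n ≤ p j → len p (j + 1) ≤ eps ^ ((y + 1) * p n) :=
    fun j hj hn => pow_le_pow_of_le_one eps_pos.le eps_le_one
      (Nat.mul_le_mul (lt_heightFactor hj) hn)
  split_ifs with h
  · obtain ⟨j, hj⟩ : ∃ j, rootCount y = j + 1 := ⟨rootCount y - 1, by omega⟩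
    rw [hj]
    exact key j hj.le (hp.monotone (by omega))
  · exact key n (by omega) le_rfl

theorem ordConnected_cover (p : ℕ → ℕ) (y n : ℕ) : (S.cover p y n).OrdConnected := by
  obtain ⟨a, ha⟩ := S.cover_eq_seg p y n
  rw [ha]
  exact Set.ordConnected_Icc

theorem cover_nonneg (hp : Growth p) {y n : ℕ} {u : ℝ} (hu : u ∈ S.cover p y n) : 0 ≤ u := by
  by_cases h : n < rootCount y
  · rw [S.cover_of_lt h] at hu
    have := (rootSeg_subset p h hu).1
    have : (0 : ℝ) ≤ rootCount y := Nat.cast_nonneg _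
    linarith
  · have hb : 2 * y ≤ block n := rootCount_le_iff.1 (by omega)
    by_cases h' : S.top (block n) ≤ y
    · rw [S.cover_of_top_le (by omega) h'] at hu
      exact (S.node_subset_Icc hp (valid_even.2 ⟨hb, h'⟩) hu).1
    · rw [S.cover_of_lt_top (by omega) (by omega)] at hu
      exact (S.node_subset_Icc hp
        (valid_odd.2 ⟨S.two_mul_top_le _, rfl, by omega⟩) hu).1

/-! ### A family with an empty member does not cover the intersection. -/

section Uncovered

variable {J : ℕ → Set ℝ}

/-- A node that is met by none of the sets `J l` with `l` below its level. -/
def Unmet (p : ℕ → ℕ) (J : ℕ → Set ℝ) (s c : ℕ) : Prop :=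
  Valid S.top s c ∧ ∀ l < level s c, Disjoint (J l) (S.node p s c)

/-- All children of the node are met in time. -/
def ChildrenMet (p : ℕ → ℕ) (J : ℕ → Set ℝ) (s c : ℕ) : Prop :=
  ∀ n, 2 * s ≤ block n → S.top (block n) ≤ s → S.parent (block n) s = c →
    ∃ l ≤ n, ¬ Disjoint (J l) (S.node p (s + 1) (2 * n))

/-- Otherwise pick for each interval `n` a set `J (g n)` meeting it in time. Separation makes `g`
permute the indices of the roots and then, inductively, fix all later ones, so `g` takes the value
`k`, although `J k` is empty. -/
theorem exists_cover_unmet (hp : Growth p)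
    (hJ : ∀ l, ∀ u ∈ J l, ∀ v ∈ J l, |u - v| ≤ eps ^ p l) {k : ℕ} (hk : J k = ∅) (y : ℕ) :
    ∃ n, ∀ l < (if n < rootCount y then rootCount y else n + 1),
      Disjoint (J l) (S.cover p y n) := by
  by_contra! hcon
  choose g hg hd using hcon
  have hfar : ∀ {m n}, m < rootCount y → m ≠ n → ¬ Disjoint (J (g m)) (S.cover p y n) → False := by
    intro m n hm hmn hn
    obtain ⟨u, hu, hu'⟩ := Set.not_disjoint_iff.1 (hd m)
    obtain ⟨v, hv, hv'⟩ := Set.not_disjoint_iff.1 hn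
    have h1 := S.cover_dist_root hp hm hmn hu' hv'
    have h2 := hJ _ u hu v hv
    have h3 := eps_pow_lt_one hp (g m)
    linarith
  have hlt : ∀ n, n < rootCount y → g n < rootCount y := fun n hn => by
    simpa [hn] using hg n
  have hsurj : Function.Surjective
      (fun n : Fin (rootCount y) => (⟨g n, hlt n n.2⟩ : Fin (rootCount y))) := by
    rw [← Finite.injective_iff_surjective]
    intro m n hmn
    by_contra hne
    have h1 : g m = g n := congrArg Fin.val hmn
    refine hfar m.2 (fun h => hne (Fin.ext h)) (n := n) ?_
    rw [h1]
    exact hd n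
  have hroot : ∀ l < rootCount y, ∃ n < rootCount y, g n = l := fun l hl => by
    obtain ⟨n, hn⟩ := hsurj ⟨l, hl⟩
    exact ⟨n, n.2, congrArg Fin.val hn⟩
  have hdiag : ∀ n, rootCount y ≤ n → g n = n := by
    intro n
    induction n using Nat.strong_induction_on with
    | _ n ih =>
      intro hn
      have h1 := hg n
      rw [if_neg (by omega)] at h1
      by_contra hne
      by_cases h2 : g n < rootCount y
      · obtain ⟨m, hm, hgm⟩ := hroot _ h2
        refine hfar hm (n := n) (by omega) ?_
        rw [hgm]
        exact hd n
      -- By induction `J (g n)` already meets interval `g n`, which is too far from interval `n`.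
      · have h3 := ih (g n) (by omega) (by omega)
        have h4 := hd (g n)
        rw [h3] at h4
        obtain ⟨u, hu, hu'⟩ := Set.not_disjoint_iff.1 h4
        obtain ⟨v, hv, hv'⟩ := Set.not_disjoint_iff.1 (hd n)
        have h5 := S.cover_sep hp (by omega) (by omega : g n < n) hu' hv'
        exact absurd (hJ _ u hu v hv) (not_le.2 h5)
  obtain ⟨n, hn⟩ : ∃ n, g n = k := by
    by_cases h : k < rootCount y
    · obtain ⟨n, -, hn⟩ := hroot k h
      exact ⟨n, hn⟩
    · exact ⟨k, hdiag k (by omega)⟩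
  have := hd n
  rw [hn, hk] at this
  exact this (Set.empty_disjoint _)

theorem isCompact_node (s c : ℕ) : IsCompact (S.node p s c) := isCompact_Icc

theorem node_nonempty (s c : ℕ) : (S.node p s c).Nonempty :=
  Set.nonempty_Icc.2 (by linarith [len_pos p (level s c)])

/-- Otherwise unmet children can be chosen forever. Their nested intersection contains a point of
the limit set, and any `J l` containing it would meet a chain member of level above `l`. -/
theorem exists_childrenMet (hp : Growth p) (hX : S.limitSet p ⊆ ⋃ l, J l) {s c : ℕ}
    (h : S.Unmet p J s c) : ∃ s' c', s ≤ s' ∧ S.Unmet p J s' c' ∧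
      S.node p s' c' ⊆ S.node p s c ∧ S.ChildrenMet p J s' c' := by
  by_contra! hcon
  set P : ℕ → ℕ → Prop := fun i e => S.Unmet p J (s + i) e ∧ S.node p (s + i) e ⊆ S.node p s c
    with hP
  have hstep : ∀ i e, P i e → ∃ n, P (i + 1) (2 * n) ∧ 2 * (s + i) ≤ block n ∧
      S.top (block n) ≤ s + i ∧ S.parent (block n) (s + i) = e := by
    intro i e he
    have h1 := hcon (s + i) e (by omega) he.1 he.2
    simp only [ChildrenMet] at h1
    push Not at h1
    obtain ⟨n, hb, ht, hpar, hn⟩ := h1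
    refine ⟨n, ⟨⟨valid_even.2 ⟨hb, ht⟩, fun l hl => ?_⟩, ?_⟩, hb, ht, hpar⟩
    · have h2 := level_even (s + i) n
      rw [← add_assoc, h2] at hl
      exact hn l (by omega)
    · refine (S.node_even_subset hp hb ht).trans ?_
      rw [hpar]
      exact he.2
  choose next hnext using hstep
  let chain : ∀ i, {e // P i e} := fun i =>
    Nat.rec ⟨c, h, subset_rfl⟩ (fun i e => ⟨2 * next i e.1 e.2, (hnext i e.1 e.2).1⟩) i
  set N : ℕ → ℕ := fun i => next i (chain i).1 (chain i).2 with hN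
  have hchain : ∀ i, (chain (i + 1)).1 = 2 * N i := fun i => rfl
  have hspec : ∀ i, 2 * (s + i) ≤ block (N i) ∧ S.top (block (N i)) ≤ s + i ∧
      S.parent (block (N i)) (s + i) = (chain i).1 := fun i => (hnext i _ (chain i).2).2
  have hanti : ∀ i, S.node p (s + (i + 1)) (chain (i + 1)).1 ⊆ S.node p (s + i) (chain i).1 := by
    intro i
    obtain ⟨h1, h2, h3⟩ := hspec i
    have := S.node_even_subset hp h1 h2
    rwa [h3] at this
  obtain ⟨u, hu⟩ := IsCompact.nonempty_iInter_of_sequence_nonempty_isCompact_isClosed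
    (fun i => S.node p (s + i) (chain i).1) hanti (fun i => S.node_nonempty _ _)
    (S.isCompact_node _ _) (fun i => (S.isCompact_node _ _).isClosed)
  rw [Set.mem_iInter] at hu
  have hlevel : ∀ i, i ≤ level (s + i) (chain i).1 := by
    intro i
    induction i with
    | zero => omega
    | succ i ih =>
      obtain ⟨h1, h2, h3⟩ := hspec i
      have h4 := S.level_parent_le h1 h2
      rw [h3] at h4
      have h5 := level_even (s + i) (N i)
      rw [hchain, ← add_assoc, h5]
      omega
  have huX : u ∈ S.limitSet p := by
    refine Set.mem_iInter.2 fun y => ?_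
    by_cases hy : y < s
    · exact S.node_subset_iUnion_cover hp h.1 hy (hu 0)
    · obtain ⟨i, rfl⟩ : ∃ i, y = s + i := ⟨y - s, by omega⟩
      obtain ⟨h1, h2, h3⟩ := hspec i
      refine Set.mem_iUnion.2 ⟨N i, ?_⟩
      rw [S.cover_of_top_le (rootCount_le_iff.2 h1) h2]
      exact hu (i + 1)
  obtain ⟨l, hl⟩ := Set.mem_iUnion.1 (hX huX)
  have h1 := hlevel (l + 1)
  exact Set.disjoint_left.1 ((chain (l + 1)).2.1.2 l (by omega)) hl (hu (l + 1))

theorem false_of_childrenMet (hp : Growth p)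
    (hJ : ∀ l, ∀ u ∈ J l, ∀ v ∈ J l, |u - v| ≤ eps ^ p l) {s c s' c' : ℕ}
    (h : S.Unmet p J s c) (hmet : S.ChildrenMet p J s c) (h' : S.Unmet p J s' c')
    (hmet' : S.ChildrenMet p J s' c') (hs : s < s')
    (hdisj : ∀ l, ¬ Disjoint (J l) (S.node p s c) → ¬ Disjoint (J l) (S.node p s' c') → False) :
    False := by
  obtain ⟨b, hb, ht, hl, hl', hc, hc'⟩ := S.exists_pair s s' c c' hs h.1 h'.1
  refine not_both_met hp hJ _ _ hl h.2 (fun n hn => ?_) hl' h'.2 (fun n hn => ?_) hdisj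
  · subst hn
    have := hmet n (by omega) ht hc
    rwa [node_even, hc] at this
  · subst hn
    have := hmet' n hb (by omega) hc'
    rwa [node_even, hc'] at this

/-- The node found below `[0, 1]` has some stage `s`. An unmet interval of the cover of the same
stage `s` then yields a competitor for one of its blocks, whichever of the three kinds that interval
has. -/
theorem not_limitSet_subset (hp : Growth p)
    (hJ : ∀ l, ∀ u ∈ J l, ∀ v ∈ J l, |u - v| ≤ eps ^ p l) {k : ℕ} (hk : J k = ∅) :
    ¬ S.limitSet p ⊆ ⋃ l, J l := by
  intro hX
  have hfar : ∀ {A B : Set ℝ}, (∀ u ∈ A, ∀ v ∈ B, 1 ≤ |u - v|) →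
      ∀ l, ¬ Disjoint (J l) A → ¬ Disjoint (J l) B → False := by
    intro A B hAB l hA hB
    obtain ⟨u, hu, hu'⟩ := Set.not_disjoint_iff.1 hA
    obtain ⟨v, hv, hv'⟩ := Set.not_disjoint_iff.1 hB
    exact absurd ((hAB u hu' v hv').trans (hJ l u hu v hv)) (not_le.2 (eps_pow_lt_one hp l))
  obtain ⟨s, c, -, hun, -, hmet⟩ := S.exists_childrenMet hp hX (s := 0) (c := 0)
    ⟨rfl, fun l hl => absurd hl (Nat.not_lt_zero l)⟩
  have hnode : ∀ {s' c'}, s < s' → S.Unmet p J s' c' →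
      (∀ l, ¬ Disjoint (J l) (S.node p s c) → ¬ Disjoint (J l) (S.node p s' c') → False) →
      False := by
    intro s' c' hs hun' hdisj
    obtain ⟨s'', c'', hs', hun'', hsub, hmet''⟩ := S.exists_childrenMet hp hX hun'
    exact S.false_of_childrenMet hp hJ hun hmet hun'' hmet'' (by omega)
      fun l h1 h2 => hdisj l h1 fun h3 => h2 (h3.mono_right hsub)
  obtain ⟨n, hn⟩ := S.exists_cover_unmet hp hJ hk s
  by_cases hns : n < rootCount s
  · rw [if_pos hns, S.cover_of_lt hns] at hn
    have hs : 1 ≤ s := by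
      by_contra hs
      obtain rfl : s = 0 := by omega
      rw [rootCount_zero] at hns
      omega
    have hdist : ∀ u ∈ S.node p s c, ∀ v ∈ rootSeg p s n, 1 ≤ |u - v| := fun u hu v hv =>
      S.node_dist_rootSeg hp hun.1 le_rfl hns hu hv
    by_cases hpiece : ∃ m, S.top (block m) = s ∧ S.root (block m) = n ∧
        S.Unmet p J (s + 1) (2 * m + 1)
    · obtain ⟨m, ht, hr, hm⟩ := hpiece
      have hsub := S.node_odd_subset (p := p) hp (valid_odd.1 hm.1).1
      rw [hr] at hsub
      exact hnode (by omega) hm (hfar fun u hu v hv => hdist u hu v (hsub hv))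
    -- With no unmet piece, the root itself competes: all its pieces in the shared block are met in
    -- time.
    · push Not at hpiece
      obtain ⟨b, hb, hl, ht, hr, hc⟩ := S.exists_root s c n hs hun.1 hns
      refine not_both_met hp hJ (b := b) _ (rootPos s n) hl hun.2 (fun m hm => ?_)
        (blockStart_mono hb) hn (fun m hm => ?_) (hfar hdist)
      · subst hm
        have := hmet m hb ht.le hc
        rwa [node_even, hc] at this
      · subst hm
        by_contra! hcon
        refine hpiece m ht hr ⟨valid_odd.2 ⟨hb, ht, hs⟩, fun l hl => ?_⟩
        rw [level_odd] at hl
        rw [node_odd, hr]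
        exact hcon l (by omega)
  · rw [if_neg hns] at hn
    have hb : 2 * s ≤ block n := rootCount_le_iff.1 (by omega)
    by_cases ht : S.top (block n) ≤ s
    · rw [S.cover_of_top_le (by omega) ht] at hn
      refine hnode (by omega) ⟨valid_even.2 ⟨hb, ht⟩, by rwa [level_even]⟩ fun l h1 h2 => ?_
      by_cases hc : S.parent (block n) s = c
      · obtain ⟨j, hj, hd⟩ := hmet n hb ht hc
        exact hd (hn j (by omega))
      -- The node `c` is unmet, so only late `J l` reach it, and these are too short to reach
      -- another node of stage `s`.
      · have hl : level s c ≤ l := by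
          by_contra hl
          exact h1 (hun.2 l (by omega))
        obtain ⟨u, hu, hu'⟩ := Set.not_disjoint_iff.1 h1
        obtain ⟨v, hv, hv'⟩ := Set.not_disjoint_iff.1 h2
        have := S.node_sep hp (l := l) hun.1 (S.valid_parent _ _ ht hb).1 (Ne.symm hc) hu'
          (S.node_even_subset hp hb ht hv') (by omega)
        exact absurd (hJ l u hu v hv) (not_le.2 this)
    · have hsub := S.cover_lt_top_subset hp (p := p) (y := s) (n := n) (by omega) (by omega)
      rw [S.cover_of_lt_top (by omega) (by omega)] at hn hsub
      refine hnode (s' := S.top (block n) + 1) (c' := 2 * n + 1) (by omega)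
        ⟨valid_odd.2 ⟨S.two_mul_top_le _, rfl, by omega⟩, by rwa [level_odd]⟩ (hfar fun u hu v hv => ?_)
      exact S.node_dist_rootSeg hp hun.1 (by omega) (S.root_lt _ (by omega)) hu (hsub hv)

end Uncovered

end Schedule

/-! ### The main theorem. -/

theorem abs_sub_le_of_volume_le {I : Set ℝ} (hI : I.OrdConnected) {d : ℝ} (hd : 0 ≤ d)
    (h : MeasureTheory.volume I ≤ ENNReal.ofReal d) {u v : ℝ} (hu : u ∈ I) (hv : v ∈ I) :
    |u - v| ≤ d := by
  wlog huv : v ≤ u generalizing u v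
  · rw [abs_sub_comm]
    exact this hv hu (by linarith)
  have h1 := (MeasureTheory.measure_mono (hI.out hv hu)).trans h
  rw [Real.volume_Icc, ENNReal.ofReal_le_ofReal_iff hd] at h1
  rwa [abs_of_nonneg (by linarith)]

/-- If the quotients of the exponents grow fast, there are a microscopic set and a point whose union
is not microscopic. -/
theorem exists_isMicroscopic_union_singleton_not {p : ℕ → ℕ} (hp : Growth p) :
    ∃ (X : Set ℝ) (x : ℝ), IsMicroscopic (fun n ε => ε ^ p n) X ∧
      ¬ IsMicroscopic (fun n ε => ε ^ p n) (X ∪ {x}) := by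
  obtain ⟨S⟩ := exists_schedule
  -- The covers lie in the nonnegative reals, so an interval of length below 1 containing -10 misses
  -- the limit set and may be replaced by the empty set.
  refine ⟨S.limitSet p, -10, fun ε hε => ?_, fun h => ?_⟩
  · obtain ⟨y, hy⟩ := exists_pow_lt_of_lt_one hε.1 eps_lt_one
    refine ⟨S.cover p y, S.ordConnected_cover p y, Set.iInter_subset _ y, fun n =>
      (S.volume_cover_le p hp y n).trans (ENNReal.ofReal_le_ofReal ?_)⟩
    refine pow_le_pow_left₀ (pow_nonneg eps_pos.le _) ?_ _
    exact (pow_le_pow_of_le_one eps_pos.le eps_le_one (Nat.le_succ y)).trans hy.le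
  · obtain ⟨I, hI, hcov, hvol⟩ := h eps ⟨eps_pos, eps_lt_one⟩
    have hdiam : ∀ l, ∀ u ∈ I l, ∀ v ∈ I l, |u - v| ≤ eps ^ p l := fun l u hu v hv =>
      abs_sub_le_of_volume_le (hI l) (pow_nonneg eps_pos.le _) (hvol l) hu hv
    obtain ⟨k, hk⟩ := Set.mem_iUnion.1 (hcov (Or.inr rfl))
    refine S.not_limitSet_subset hp (J := Function.update I k ∅) (k := k) (fun l u hu v hv => ?_)
      (Function.update_self _ _ _) fun u hu => ?_
    · by_cases hl : l = k
      · subst hl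
        simp at hu
      · rw [Function.update_of_ne hl] at hu hv
        exact hdiam l u hu v hv
    · obtain ⟨l, hl⟩ := Set.mem_iUnion.1 (hcov (Or.inl hu))
      obtain ⟨n, hn⟩ := Set.mem_iUnion.1 (Set.mem_iInter.1 hu 0)
      have h0 := S.cover_nonneg hp hn
      refine Set.mem_iUnion.2 ⟨l, ?_⟩
      rw [Function.update_of_ne]
      · exact hl
      · rintro rfl
        have h1 := hdiam l u hl _ hk
        have h2 := eps_pow_lt_one hp l
        have h3 := le_abs_self (u - -10)
        linarith

/-- The exponents of `skipSeq k`. -/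
def skipExponent (k n : ℕ) : ℕ :=
  if n < k then Nat.factorial (n + 1) else Nat.factorial (n + 2)

theorem skipSeq_eq (k : ℕ) : skipSeq k = fun n ε => ε ^ skipExponent k n := by
  funext n ε
  unfold skipSeq skipExponent
  split_ifs <;> rfl

theorem growth_skipExponent (k : ℕ) : Growth (skipExponent k) where
  one_le := Nat.one_le_iff_ne_zero.2 <| by
    unfold skipExponent
    split_ifs <;> exact Nat.factorial_ne_zero _
  mul_le n := by
    have h1 : (n + 2) * Nat.factorial (n + 1) = Nat.factorial (n + 2) := rfl
    have h2 : (n + 3) * Nat.factorial (n + 2) = Nat.factorial (n + 3) := rfl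
    unfold skipExponent
    split_ifs with h3 h4
    · exact h1.le
    · rw [h1]
      exact Nat.factorial_le (by omega)
    · omega
    · rw [show n + 1 + 2 = n + 3 from rfl, ← h2]
      exact Nat.mul_le_mul_right _ (by omega)

/-- The exponent `(k + 1)!` skipped by `skipSeq k` leaves slot `k` free for the point; later
intervals move up by one slot. -/
theorem isPicoscopic_union_singleton {k : ℕ} {X : Set ℝ} (hX : IsMicroscopic (skipSeq k) X)
    (x : ℝ) : IsPicoscopic (X ∪ {x}) := by
  intro ε hε
  obtain ⟨I, hI, hcov, hvol⟩ := hX ε hε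
  refine ⟨fun n => if n < k then I n else if n = k then {x} else I (n - 1), fun n => ?_, ?_,
    fun n => ?_⟩
  · dsimp only
    split_ifs
    · exact hI n
    · exact Set.ordConnected_singleton
    · exact hI _
  · rintro u (hu | rfl)
    · obtain ⟨n, hn⟩ := Set.mem_iUnion.1 (hcov hu)
      by_cases h : n < k
      · exact Set.mem_iUnion.2 ⟨n, by simpa [h] using hn⟩
      · refine Set.mem_iUnion.2 ⟨n + 1, ?_⟩
        rw [if_neg (by omega), if_neg (by omega)]
        exact hn
    · exact Set.mem_iUnion.2 ⟨k, by simp⟩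
  · dsimp only
    split_ifs with h1 h2
    · simpa [skipSeq, h1] using hvol n
    · simp
    · have h3 := hvol (n - 1)
      rwa [skipSeq, if_neg (by omega), show n - 1 + 2 = n + 1 by omega] at h3

end Microscopic

theorem mainTheorem7 (k : ℕ) :
    (∃ (X : Set ℝ) (x : ℝ), IsMicroscopic (skipSeq k) X ∧
      ¬ IsMicroscopic (skipSeq k) (X ∪ {x})) ∧
    (∃ Y : Set ℝ, IsPicoscopic Y ∧ ¬ IsMicroscopic (skipSeq k) Y) := by
  obtain ⟨X, x, hX, hx⟩ := Microscopic.exists_isMicroscopic_union_singleton_not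
    (Microscopic.growth_skipExponent k)
  rw [← Microscopic.skipSeq_eq] at hX hx
  exact ⟨⟨X, x, hX, hx⟩, X ∪ {x}, Microscopic.isPicoscopic_union_singleton hX x, hx⟩
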